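/- Let $n\in\mathbb N$ and $s>1$. Let $\phi\in C^\infty(\mathbb R^n;\mathbb C)$ belong to the Gelfand--Shilov space $\mathcal S^{(s)}(\mathbb R^n)$, i.e. for every $b>0$ $$\sup_{\alpha,\beta\in\mathbb N^n}\int_{\mathbb R^n}\frac{|x^\beta|}{b^{|\alpha+\beta|}\,\alpha!^s\,\beta!^s}\,|\partial^\alpha\phi(x)|\,dx<\infty,$$ and suppose that $\int\phi(x)\,dx=1$ and $\int x^\alpha\phi(x)\,dx=0$ for all multi-indices $\alpha\ne0$. Let $\chi\in C^\infty(\mathbb R^n)$ be of Gevrey class $s$ (for every compact $K$ there is $A>0$ with $\sup_{x\in K}|\partial^\alpha\chi(x)|\le A^{|\alpha|+1}(\alpha!)^s$ for all $\alpha$), with $0\le\chi\le1$, $\chi(x)=0$ for $|x|\ge2$ and $\chi(x)=1$ for $|x|\le1$. Let $(\omega(\varepsilon))_{\varepsilon\in(0,1]}$ be a net of positive real numbers (for instance one tending to $0$ as $\varepsilon\to0$), and set $$\rho_{\omega(\varepsilon)}(x)=\omega(\varepsilon)^{-n}\,\phi\Bigl(\frac{x}{\omega(\varepsilon)}\Bigr)\,\chi\bigl(x\,|\log\omega(\varepsilon)|\bigr).$$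 Let $v\in\mathcal E'(\mathbb R^n)$ be a compactly supported distribution, i.e. a continuous linear functional on $C^\infty(\mathbb R^n)$. Write $\widehat v(\xi)=\langle v,e^{-ix\cdot\xi}\rangle$, $(v*\rho)(x)=\langle v,\rho(x-\cdot)\rangle$, $\widehat f(\xi)=\int e^{-ix\cdot\xi}f(x)\,dx$ for $f\in L^1(\mathbb R^n)$, and $\langle\xi\rangle=(1+|\xi|^2)^{1/2}$. Then $v*\rho_{\omega(\varepsilon)}$ is integrable for every $\varepsilon\in(0,1]$, and there exist $\nu>0$, $C>0$ and, for every $q\in\mathbb N$, a constant $c_q>0$ such that $$\bigl|\widehat{v*\rho_{\omega(\varepsilon)}}(\xi)-\widehat v(\xi)\bigr|\le c_q\,C\,\omega(\varepsilon)^q\,e^{\nu\langle\xi\rangle^{1/s}}$$ for all $\xi\in\mathbb R^n$ and all $\varepsilon\in(0,1]$. -/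

import Mathlib

namespace GevreyReg

open scoped ContDiff ENNReal RealInnerProductSpace

noncomputable section

/-- The Euclidean space `ℝⁿ`. -/
abbrev E (n : ℕ) : Type := EuclideanSpace ℝ (Fin n)

/-! ### Multi-indices and partial derivatives -/

/-- The length `|α| = α₁ + ⋯ + αₙ` of a multi-index. -/
def mlen {n : ℕ} (α : Fin n → ℕ) : ℕ := ∑ i, α i

/-- The factorial `α! = α₁! ⋯ αₙ!` of a multi-index, as a real number. -/
def mfact {n : ℕ} (α : Fin n → ℕ) : ℝ := ∏ i, (Nat.factorial (α i) : ℝ)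

/-- The monomial `x^α = x₁^α₁ ⋯ xₙ^αₙ`. -/
def mpow {n : ℕ} (x : E n) (α : Fin n → ℕ) : ℝ := ∏ i, x i ^ α i

/-- The list of coordinate directions `1, …, 1, 2, …, 2, …, n, …, n` in which `i` occurs
`α i` times. -/
def mdirs {n : ℕ} (α : Fin n → ℕ) : List (Fin n) :=
  (List.finRange n).flatMap fun i => List.replicate (α i) i

/-- The partial derivative `∂^α f` of a smooth function: the derivative of order `|α|` of `f`,
evaluated at the standard basis vectors, the `i`-th one taken `α i` times. -/
def mderiv {n : ℕ} {F : Type*} [NormedAddCommGroup F] [NormedSpace ℝ F]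
    (α : Fin n → ℕ) (f : E n → F) (x : E n) : F :=
  iteratedFDeriv ℝ (mdirs α).length f x
    fun j => EuclideanSpace.single ((mdirs α).get j) (1 : ℝ)

/-! ### The space of smooth functions and its dual -/

/-- The complex vector space of smooth functions `ℝⁿ → ℂ`, as a subspace of all functions. -/
def smoothSubmodule (n : ℕ) : Submodule ℂ (E n → ℂ) where
  carrier := {f | ContDiff ℝ ∞ f}
  add_mem' := fun hf hg => by
    rw [Set.mem_ofPred_eq] at *
    exact ContDiff.add hf hg
  zero_mem' := by
    rw [Set.mem_ofPred_eq]
    exact contDiff_const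
  smul_mem' := fun c f hf => by
    rw [Set.mem_ofPred_eq] at *
    exact ContDiff.const_smul c hf

/-- The space `C^∞(ℝⁿ)` of complex-valued smooth functions; it is given its usual topology
below. (A separate type, so that it does not carry the topology of pointwise convergence.) -/
def SmoothFn (n : ℕ) : Type := smoothSubmodule n

instance (n : ℕ) : AddCommGroup (SmoothFn n) := inferInstanceAs (AddCommGroup (smoothSubmodule n))

instance (n : ℕ) : Module ℂ (SmoothFn n) := inferInstanceAs (Module ℂ (smoothSubmodule n))

/-- A smooth function as an element of `C^∞(ℝⁿ)`. -/
def SmoothFn.mk {n : ℕ} (f : E n → ℂ) (hf : ContDiff ℝ ∞ f) : SmoothFn n := ⟨f, hf⟩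

/-- The function underlying an element of `C^∞(ℝⁿ)`. -/
def SmoothFn.fn {n : ℕ} (f : SmoothFn n) : E n → ℂ := f.1

theorem SmoothFn.contDiff {n : ℕ} (f : SmoothFn n) : ContDiff ℝ ∞ f.fn := f.2

theorem SmoothFn.fn_mk {n : ℕ} (f : E n → ℂ) (hf : ContDiff ℝ ∞ f) :
    (SmoothFn.mk f hf).fn = f := rfl

theorem SmoothFn.fn_add {n : ℕ} (f g : SmoothFn n) : (f + g).fn = f.fn + g.fn := rfl

theorem SmoothFn.fn_smul {n : ℕ} (c : ℂ) (f : SmoothFn n) : (c • f).fn = c • f.fn := rfl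

theorem SmoothFn.bddAbove {n : ℕ} (K : TopologicalSpace.Compacts (E n)) (k : ℕ)
    (f : SmoothFn n) :
    BddAbove (Set.range fun x : K => ‖iteratedFDeriv ℝ k f.fn x‖) := by
  have hc : Continuous fun x => ‖iteratedFDeriv ℝ k f.fn x‖ :=
    (f.contDiff.continuous_iteratedFDeriv (by exact_mod_cast le_top)).norm
  have hb := (K.isCompact.image hc).bddAbove
  refine hb.mono ?_
  rintro _ ⟨x, rfl⟩
  exact ⟨x, x.2, rfl⟩

/-- The seminorm `f ↦ sup_{x ∈ K} ‖D^k f(x)‖` on `C^∞(ℝⁿ)`, for `K` compact and `k ∈ ℕ`. -/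
def smoothSeminorm (n : ℕ) : SeminormFamily ℂ (SmoothFn n) (TopologicalSpace.Compacts (E n) × ℕ) :=
  fun p => Seminorm.of (fun f => ⨆ x : p.1, ‖iteratedFDeriv ℝ p.2 f.fn x‖)
    (fun f g => by
      have hf : ContDiff ℝ p.2 f.fn := f.contDiff.of_le (by exact_mod_cast le_top)
      have hg : ContDiff ℝ p.2 g.fn := g.contDiff.of_le (by exact_mod_cast le_top)
      refine Real.iSup_le (fun x => ?_) (add_nonneg
        (Real.iSup_nonneg fun _ => norm_nonneg _) (Real.iSup_nonneg fun _ => norm_nonneg _))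
      rw [SmoothFn.fn_add, iteratedFDeriv_add_apply hf.contDiffAt hg.contDiffAt]
      exact (norm_add_le _ _).trans (add_le_add (le_ciSup (SmoothFn.bddAbove p.1 p.2 f) x)
        (le_ciSup (SmoothFn.bddAbove p.1 p.2 g) x)))
    (fun c f => by
      have hf : ContDiff ℝ p.2 f.fn := f.contDiff.of_le (by exact_mod_cast le_top)
      rw [Real.mul_iSup_of_nonneg (norm_nonneg c)]
      refine iSup_congr fun x => ?_
      rw [SmoothFn.fn_smul, iteratedFDeriv_const_smul_apply hf.contDiffAt, norm_smul])

/-- The usual Fréchet topology of `C^∞(ℝⁿ)`: uniform convergence of all derivatives on all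
compact sets. -/
instance (n : ℕ) : TopologicalSpace (SmoothFn n) := (smoothSeminorm n).moduleFilterBasis.topology

theorem smooth_withSeminorms (n : ℕ) : WithSeminorms (smoothSeminorm n) := ⟨rfl⟩

/-- The space `ℰ'(ℝⁿ)` of compactly supported distributions: the continuous linear functionals
on `C^∞(ℝⁿ)`. -/
abbrev CompDistrib (n : ℕ) : Type := SmoothFn n →L[ℂ] ℂ

/-- The character `x ↦ e^{-i x·ξ}`. -/
def expFn {n : ℕ} (ξ : E n) : SmoothFn n :=
  SmoothFn.mk (fun x => Complex.exp (-Complex.I * (⟪x, ξ⟫ : ℝ)))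
    (Complex.contDiff_exp.comp (contDiff_const.mul
      (Complex.ofRealCLM.contDiff.comp (contDiff_id.inner ℝ contDiff_const))))

/-- The Fourier transform `v̂(ξ) = ⟨v, e^{-i x·ξ}⟩` of a compactly supported distribution. -/
def distribFT {n : ℕ} (v : CompDistrib n) (ξ : E n) : ℂ := v (expFn ξ)

/-- The convolution `(v ∗ ρ)(x) = ⟨v, ρ(x - ·)⟩` of a compactly supported distribution and a
smooth function. -/
def distribConv {n : ℕ} (v : CompDistrib n) (ρ : SmoothFn n) (x : E n) : ℂ :=
  v (SmoothFn.mk (fun y => ρ.fn (x - y)) (ρ.contDiff.comp (contDiff_const.sub contDiff_id)))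

/-- The Fourier transform `f̂(ξ) = ∫ e^{-i x·ξ} f(x) dx` of an integrable function. -/
def funFT {n : ℕ} (f : E n → ℂ) (ξ : E n) : ℂ :=
  ∫ x : E n, Complex.exp (-Complex.I * (⟪x, ξ⟫ : ℝ)) * f x

/-! ### Gelfand–Shilov mollifiers and Gevrey cut-offs -/

/-- The Gelfand–Shilov norm
`‖f‖_{b,s} = sup_{α,β} ∫ |x^β| / (b^{|α+β|} α!^s β!^s) |∂^α f(x)| dx`, with values in `[0,∞]`. -/
def gsNorm {n : ℕ} (b s : ℝ) (f : E n → ℂ) : ℝ≥0∞ :=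
  ⨆ (α : Fin n → ℕ) (β : Fin n → ℕ), ∫⁻ x : E n, ENNReal.ofReal
    (|mpow x β| / (b ^ mlen (α + β) * mfact α ^ s * mfact β ^ s) * ‖mderiv α f x‖)

/-- A mollifier: an element `φ` of the Gelfand–Shilov space `𝒮^{(s)}(ℝⁿ)` with `∫ φ = 1` all of
whose moments of positive order vanish. -/
structure GSMollifier (n : ℕ) (s : ℝ) where
  /-- the underlying function -/
  fn : E n → ℂ
  contDiff : ContDiff ℝ ∞ fn
  gsNorm_lt_top : ∀ b : ℝ, 0 < b → gsNorm b s fn < ⊤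
  integral_eq_one : ∫ x : E n, fn x = 1
  moment_eq_zero : ∀ α : Fin n → ℕ, α ≠ 0 → ∫ x : E n, (mpow x α : ℂ) * fn x = 0

/-- A Gevrey cut-off of order `s`: a function `χ ∈ γ^s(ℝⁿ)` with `0 ≤ χ ≤ 1`, with `χ(x) = 0` for
`|x| ≥ 2` and `χ(x) = 1` for `|x| ≤ 1`. -/
structure GevreyCutoff (n : ℕ) (s : ℝ) where
  /-- the underlying function -/
  fn : E n → ℝ
  contDiff : ContDiff ℝ ∞ fn
  gevrey : ∀ K : Set (E n), IsCompact K → ∃ C : ℝ, 0 < C ∧ ∀ α : Fin n → ℕ, ∀ x ∈ K,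
    |mderiv α fn x| ≤ C ^ (mlen α + 1) * mfact α ^ s
  nonneg : ∀ x, 0 ≤ fn x
  le_one : ∀ x, fn x ≤ 1
  eq_zero : ∀ x, 2 ≤ ‖x‖ → fn x = 0
  eq_one : ∀ x, ‖x‖ ≤ 1 → fn x = 1

/-- The function `ρ_w(x) = w^{-n} φ(x / w) χ(x |log w|)`. -/
def rho {n : ℕ} {s : ℝ} (φ : GSMollifier n s) (χ : GevreyCutoff n s) (w : ℝ) : SmoothFn n :=
  SmoothFn.mk
    (fun x => ((w ^ n)⁻¹ : ℝ) * φ.fn (w⁻¹ • x) * (χ.fn (|Real.log w| • x) : ℂ))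
    ((contDiff_const.mul (φ.contDiff.comp (contDiff_const_smul _))).mul
      (Complex.ofRealCLM.contDiff.comp (χ.contDiff.comp (contDiff_const_smul _))))

/-- The bracket `⟨ξ⟩ = (1 + |ξ|²)^{1/2}`. -/
def bracket {n : ℕ} (ξ : E n) : ℝ := Real.sqrt (1 + ‖ξ‖ ^ 2)

end

end GevreyReg

open GevreyReg

/-!
The Fourier transform of `v ∗ ρ_w` is the product of those of `v` and `ρ_w`, so that the difference
to be estimated is `v̂(ξ) (ρ̂_w(ξ) - 1)`, and both factors are bounded by powers.

* `GSMollifier.exists_schwartzMap_eq`: the Gelfand–Shilov norm for `b = 1` gives integrability of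
  all derivatives of `φ` against all polynomials, and hence `φ` is a Schwartz function. It follows
  that `ρ_w` is a Schwartz function for every `w > 0`, including `w = 1`, where the cut-off is
  identically `1`.
* `funFT_distribConv`: `v` factors through the Banach space of finitely many jets on compact sets
  (`CompDistrib.exists_eq_comp_jet`). In this space `x ↦ ρ(x - ·)` is Bochner integrable, so `v`
  commutes with the Fourier integral. The same factorization shows that `v̂` grows at most
  polynomially (`exists_norm_distribFT_le`).
* `exists_norm_funFT_rho_sub_one_le`: for every `q`,
  `|ρ̂_w(ξ) - 1| ≤ C_q w^q (1 + |ξ|)^{q+1}` for all `w > 0`. Since the moments of positive order of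
  `φ` vanish, a Taylor polynomial of the character can be subtracted, which gives the factor `w^q`;
  the cut-off differs from `1` only where `|x| ≥ 1 / |log w|`, which costs
  `O((w |log w|)^{2q}) = O(w^q)`.

Every power of `⟨ξ⟩` is dominated by a multiple of `e^{⟨ξ⟩^{1/s}}`, the multiple depending on `q`
(`exists_pow_le_exp_rpow`). Hence `ν = 1` is admissible.
-/

namespace GevreyReg

open MeasureTheory
open scoped ContDiff RealInnerProductSpace SchwartzMap FourierTransform

/-! ### Gelfand–Shilov functions are Schwartz functions -/

/-- The iterated partial derivative of `f` along a list of coordinate directions. -/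
noncomputable def listDeriv {n : ℕ} {F : Type*} [NormedAddCommGroup F] [NormedSpace ℝ F]
    (l : List (Fin n)) (f : E n → F) (x : E n) : F :=
  iteratedFDeriv ℝ l.length f x fun j => EuclideanSpace.single (l.get j) (1 : ℝ)

section listDeriv

variable {n : ℕ} {F : Type*} [NormedAddCommGroup F] [NormedSpace ℝ F] {f : E n → F}

theorem contDiff_listDeriv (hf : ContDiff ℝ ∞ f) (l : List (Fin n)) :
    ContDiff ℝ ∞ (listDeriv l f) :=
  (ContinuousMultilinearMap.apply ℝ (fun _ : Fin l.length => E n) F _).contDiff.comp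
    (hf.iteratedFDeriv_right (m := ∞) (i := l.length) (by norm_cast))

theorem listDeriv_cons (hf : ContDiff ℝ ∞ f) (a : Fin n) (l : List (Fin n)) (x : E n) :
    listDeriv (a :: l) f x = fderiv ℝ (listDeriv l f) x (EuclideanSpace.single a 1) := by
  have hd : DifferentiableAt ℝ (iteratedFDeriv ℝ l.length f) x :=
    (hf.differentiable_iteratedFDeriv (by exact_mod_cast WithTop.coe_lt_top _)) x
  have h1 : listDeriv l f = fun y =>
      (ContinuousMultilinearMap.apply ℝ (fun _ : Fin l.length => E n) F
        (fun j => EuclideanSpace.single (l.get j) (1 : ℝ))) (iteratedFDeriv ℝ l.length f y) := rfl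
  have h2 := ((ContinuousMultilinearMap.apply ℝ (fun _ : Fin l.length => E n) F
    (fun j => EuclideanSpace.single (l.get j) (1 : ℝ))).hasFDerivAt.comp x hd.hasFDerivAt).fderiv
  rw [Function.comp_def] at h2
  rw [h1, h2]
  rfl

/-- Partial derivatives of a smooth function commute. -/
theorem listDeriv_perm (hf : ContDiff ℝ ∞ f) {l l' : List (Fin n)} (h : l.Perm l') :
    listDeriv l f = listDeriv l' f := by
  induction h with
  | nil => rfl
  | cons a _ ih =>
    funext x
    rw [listDeriv_cons hf, listDeriv_cons hf, ih]
  | swap a b l =>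
    funext x
    have hl := contDiff_listDeriv hf l
    have key : ∀ c d : Fin n, listDeriv (c :: d :: l) f x =
        fderiv ℝ (fderiv ℝ (listDeriv l f)) x (EuclideanSpace.single c 1)
          (EuclideanSpace.single d 1) := by
      intro c d
      have hd : DifferentiableAt ℝ (fderiv ℝ (listDeriv l f)) x :=
        ((hl.fderiv_right (m := 1) (by norm_cast)).differentiable (by norm_num)) x
      have h1 : listDeriv (d :: l) f = fun y =>
          fderiv ℝ (listDeriv l f) y (EuclideanSpace.single d 1) :=
        funext fun y => listDeriv_cons hf d l y
      rw [listDeriv_cons hf, h1, fderiv_clm_apply hd (differentiableAt_const _)]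
      simp
    rw [key, key]
    have h2 : (2 : WithTop ℕ∞) ≤ ((⊤ : ℕ∞) : WithTop ℕ∞) := by norm_cast
    exact (hl.contDiffAt.isSymmSndFDerivAt (by simpa using h2)) _ _
  | trans _ _ ih1 ih2 => exact ih1.trans ih2

/-- Up to order, a list of directions is determined by its multi-index of multiplicities. -/
theorem exists_mdirs_perm (l : List (Fin n)) : ∃ α : Fin n → ℕ, (mdirs α).Perm l := by
  refine ⟨fun a => l.count a, List.perm_iff_count.2 fun a => ?_⟩
  rw [mdirs, List.count_flatMap]
  simp only [Function.comp_def, List.count_replicate]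
  rw [← List.ofFn_eq_map, List.sum_ofFn]
  simp

/-- Every partial derivative of order `k` is some `∂^α f`, hence
`‖D^k f(x)‖ ≤ ∑_r ‖∂^{α(r)} f(x)‖`, where `r` runs over the sequences of `k` directions. -/
theorem exists_norm_iteratedFDeriv_le (hf : ContDiff ℝ ∞ f) (k : ℕ) :
    ∃ α : (Fin k → Fin n) → Fin n → ℕ, ∀ x,
      ‖iteratedFDeriv ℝ k f x‖ ≤ ∑ r, ‖mderiv (α r) f x‖ := by
  choose α hα using exists_mdirs_perm (n := n)
  refine ⟨fun r => α (List.ofFn r), fun x => ?_⟩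
  have hr : ∀ r : Fin k → Fin n, mderiv (α (List.ofFn r)) f x =
      iteratedFDeriv ℝ k f x fun j => EuclideanSpace.single (r j) 1 := by
    intro r
    have h2 : listDeriv (List.ofFn r) f x =
        iteratedFDeriv ℝ k f x fun j => EuclideanSpace.single (r j) 1 := by
      unfold listDeriv
      have : ∀ (m : ℕ) (hm : m = k) (u : Fin m → E n) (w : Fin k → E n),
          (∀ j, u j = w (Fin.cast hm j)) →
          iteratedFDeriv ℝ m f x u = iteratedFDeriv ℝ k f x w := by
        rintro m rfl u w h
        congr 1
        funext j
        exact h j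
      exact this _ (List.length_ofFn) _ _ (fun j => by simp; rfl)
    rw [← h2, ← listDeriv_perm hf (hα (List.ofFn r))]
    rfl
  simp only [hr]
  refine ContinuousMultilinearMap.opNorm_le_bound (Finset.sum_nonneg fun _ _ => norm_nonneg _)
    fun m => ?_
  have hm : m = fun j => ∑ i, m j i • EuclideanSpace.single i (1 : ℝ) := by
    funext j
    ext i
    simp [Finset.sum_apply, Pi.single_apply]
  conv_lhs => rw [hm]
  rw [ContinuousMultilinearMap.map_sum, Finset.sum_mul]
  refine (norm_sum_le _ _).trans (Finset.sum_le_sum fun r _ => ?_)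
  rw [ContinuousMultilinearMap.map_smul_univ, norm_smul, mul_comm, norm_prod]
  refine mul_le_mul_of_nonneg_left ?_ (norm_nonneg _)
  exact Finset.prod_le_prod (fun _ _ => norm_nonneg _)
    fun j _ => PiLp.norm_apply_le (m j) (r j)

end listDeriv

theorem norm_pow_le_sum_mpow {n : ℕ} (k : ℕ) (x : E n) :
    ‖x‖ ^ k ≤ ∑ β ∈ Finset.univ.piAntidiag k,
      (Nat.multinomial Finset.univ β : ℝ) * |mpow x β| := by
  have h1 : ‖x‖ ≤ ∑ i, |x i| := by
    have hx : x = ∑ i, x i • EuclideanSpace.single i (1 : ℝ) := by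
      ext i
      simp [Finset.sum_apply, Pi.single_apply]
    calc ‖x‖ = ‖∑ i, x i • EuclideanSpace.single i (1 : ℝ)‖ := by rw [← hx]
      _ ≤ ∑ i, |x i| := (norm_sum_le _ _).trans (Finset.sum_le_sum fun i _ => by
          simp [norm_smul])
  refine (pow_le_pow_left₀ (norm_nonneg _) h1 k).trans (le_of_eq ?_)
  rw [Finset.sum_pow_eq_sum_piAntidiag]
  simp [mpow, Finset.abs_prod]

theorem continuous_mpow {n : ℕ} (β : Fin n → ℕ) : Continuous fun x : E n => mpow x β := by
  unfold mpow
  fun_prop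

theorem integrable_mpow_mul_mderiv {n : ℕ} {s : ℝ} (φ : GSMollifier n s) (α β : Fin n → ℕ) :
    Integrable fun x => |mpow x β| * ‖mderiv α φ.fn x‖ := by
  have hD : Continuous fun x => mderiv α φ.fn x :=
    (contDiff_listDeriv φ.contDiff (mdirs α)).continuous
  have hc : Continuous fun x : E n => |mpow x β| * ‖mderiv α φ.fn x‖ :=
    (continuous_mpow β).abs.mul hD.norm
  set c : ℝ := 1 ^ mlen (α + β) * mfact α ^ s * mfact β ^ s with hcdef
  have hfact : ∀ γ : Fin n → ℕ, 0 < mfact γ := fun γ =>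
    Finset.prod_pos fun i _ => by positivity
  have hcpos : 0 < c := by
    have := Real.rpow_pos_of_pos (hfact α) s
    have := Real.rpow_pos_of_pos (hfact β) s
    rw [hcdef]
    positivity
  have hlt : ∫⁻ x : E n, ENNReal.ofReal (|mpow x β| / c * ‖mderiv α φ.fn x‖) < ⊤ :=
    lt_of_le_of_lt (le_iSup₂ (f := fun α β : Fin n → ℕ => ∫⁻ x : E n, ENNReal.ofReal
      (|mpow x β| / (1 ^ mlen (α + β) * mfact α ^ s * mfact β ^ s) * ‖mderiv α φ.fn x‖)) α β)
      (φ.gsNorm_lt_top 1 one_pos)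
  have hi : Integrable fun x : E n => |mpow x β| / c * ‖mderiv α φ.fn x‖ := by
    refine ⟨(((continuous_mpow β).abs.div_const c).mul hD.norm).aestronglyMeasurable, ?_⟩
    rw [hasFiniteIntegral_iff_ofReal (Filter.Eventually.of_forall fun x => by positivity)]
    exact hlt
  refine (hi.const_mul c).congr (Filter.Eventually.of_forall fun x => ?_)
  field_simp

theorem integrable_norm_pow_mul_iteratedFDeriv {n : ℕ} {s : ℝ} (φ : GSMollifier n s) (k m : ℕ) :
    Integrable fun x => ‖x‖ ^ k * ‖iteratedFDeriv ℝ m φ.fn x‖ := by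
  obtain ⟨α, hα⟩ := exists_norm_iteratedFDeriv_le φ.contDiff m
  have hi : Integrable fun x : E n => ∑ β ∈ Finset.univ.piAntidiag k, ∑ r,
      (Nat.multinomial Finset.univ β : ℝ) * (|mpow x β| * ‖mderiv (α r) φ.fn x‖) :=
    integrable_finsetSum _ fun β _ => integrable_finsetSum _ fun r _ =>
      (integrable_mpow_mul_mderiv φ (α r) β).const_mul _
  refine hi.mono' ((continuous_norm.pow k).mul (φ.contDiff.continuous_iteratedFDeriv
    (by exact_mod_cast le_top)).norm).aestronglyMeasurable
    (Filter.Eventually.of_forall fun x => ?_)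
  rw [Real.norm_of_nonneg (by positivity)]
  refine (mul_le_mul (norm_pow_le_sum_mpow k x) (hα x) (norm_nonneg _)
    (Finset.sum_nonneg fun _ _ => by positivity)).trans (le_of_eq ?_)
  simp only [Finset.sum_mul_sum, mul_assoc]

/-- A smooth function all of whose derivatives are integrable against all polynomials is a Schwartz
function: by these bounds its Fourier transform is one, and Fourier inversion applies. -/
theorem exists_schwartzMap_eq {n : ℕ} {f : E n → ℂ} (hf : ContDiff ℝ ∞ f)
    (hi : ∀ k m : ℕ, Integrable fun x => ‖x‖ ^ k * ‖iteratedFDeriv ℝ m f x‖) :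
    ∃ g : 𝓢(E n, ℂ), ⇑g = f := by
  have hfi : Integrable f := by
    refine (hi 0 0).mono' hf.continuous.aestronglyMeasurable
      (Filter.Eventually.of_forall fun x => by simp)
  let g : 𝓢(E n, ℂ) :=
    { toFun := 𝓕 f
      smooth' := Real.contDiff_fourier (N := ⊤) fun k _ => by simpa using hi k 0
      decay' := fun k m => ⟨_, fun x => Real.pow_mul_norm_iteratedFDeriv_fourier_le
        (K := ⊤) (N := ⊤) hf (fun k m _ _ => hi k m) le_top le_top x⟩ }
  have hg : ⇑g = 𝓕 f := rfl
  refine ⟨𝓕⁻ g, ?_⟩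
  rw [SchwartzMap.fourierInv_coe, hg]
  exact hf.continuous.fourierInv_fourier_eq hfi (hg ▸ g.integrable)

theorem GSMollifier.exists_schwartzMap_eq {n : ℕ} {s : ℝ} (φ : GSMollifier n s) :
    ∃ g : 𝓢(E n, ℂ), ⇑g = φ.fn :=
  GevreyReg.exists_schwartzMap_eq φ.contDiff (integrable_norm_pow_mul_iteratedFDeriv φ)

/-! ### Compactly supported distributions and jets -/

/-- Finite families of continuous jets on compact sets: a Banach space through which every
continuous functional on `C^∞(ℝⁿ)` factors. -/
def JetSpace {n : ℕ} (S : Finset (TopologicalSpace.Compacts (E n) × ℕ)) : Type :=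
  ∀ p : S, C(p.1.1, E n [×p.1.2]→L[ℝ] ℂ)

section JetSpace

variable {n : ℕ} (S : Finset (TopologicalSpace.Compacts (E n) × ℕ))

noncomputable instance : NormedAddCommGroup (JetSpace S) :=
  inferInstanceAs (NormedAddCommGroup (∀ p : S, C(p.1.1, E n [×p.1.2]→L[ℝ] ℂ)))

noncomputable instance : NormedSpace ℂ (JetSpace S) :=
  inferInstanceAs (NormedSpace ℂ (∀ p : S, C(p.1.1, E n [×p.1.2]→L[ℝ] ℂ)))

instance : CompleteSpace (JetSpace S) :=
  inferInstanceAs (CompleteSpace (∀ p : S, C(p.1.1, E n [×p.1.2]→L[ℝ] ℂ)))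

variable {S}

theorem JetSpace.norm_apply_le (G : JetSpace S) (p : S) (y : p.1.1) : ‖G p y‖ ≤ ‖G‖ :=
  ((G p).norm_coe_le_norm y).trans
    (norm_le_pi_norm (show ∀ p : S, C(p.1.1, E n [×p.1.2]→L[ℝ] ℂ) from G) p)

theorem JetSpace.norm_le {G : JetSpace S} {C : ℝ} (hC : 0 ≤ C) (h : ∀ p y, ‖G p y‖ ≤ C) :
    ‖G‖ ≤ C :=
  (pi_norm_le_iff_of_nonneg (x := (show ∀ p : S, C(p.1.1, E n [×p.1.2]→L[ℝ] ℂ) from G)) hC).2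
    fun p => (ContinuousMap.norm_le _ hC).2 (h p)

/-- The evaluation of a family of jets at one of its points, on given vectors. -/
noncomputable def JetSpace.eval (p : S) (y : p.1.1) (m : Fin p.1.2 → E n) : JetSpace S →L[ℂ] ℂ :=
  LinearMap.mkContinuous
    { toFun := fun G => G p y m
      map_add' := fun _ _ => rfl
      map_smul' := fun _ _ => rfl } (∏ j, ‖m j‖) fun G => by
        refine ((G p y).le_opNorm m).trans ?_
        rw [mul_comm]
        exact mul_le_mul_of_nonneg_left (G.norm_apply_le p y) (by positivity)

end JetSpace

/-- The jets `(D^k f|_K)_{(K,k) ∈ S}` of a smooth function. -/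
noncomputable def jet {n : ℕ} (S : Finset (TopologicalSpace.Compacts (E n) × ℕ)) :
    SmoothFn n →ₗ[ℂ] JetSpace S where
  toFun f p := ⟨fun y => iteratedFDeriv ℝ p.1.2 f.fn y,
    (f.contDiff.continuous_iteratedFDeriv (by exact_mod_cast le_top)).comp continuous_subtype_val⟩
  map_add' f g := by
    funext p
    ext1 y
    exact iteratedFDeriv_add_apply (f.contDiff.of_le (by exact_mod_cast le_top)).contDiffAt
      (g.contDiff.of_le (by exact_mod_cast le_top)).contDiffAt
  map_smul' c f := by
    funext p
    ext1 y
    exact iteratedFDeriv_const_smul_apply (f.contDiff.of_le (by exact_mod_cast le_top)).contDiffAt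

theorem jet_apply {n : ℕ} (S : Finset (TopologicalSpace.Compacts (E n) × ℕ)) (f : SmoothFn n)
    (p : S) (y : p.1.1) : jet S f p y = iteratedFDeriv ℝ p.1.2 f.fn y := rfl

/-- A continuous functional on `C^∞(ℝⁿ)` depends continuously on finitely many jets, and extends
from the space of such jets to a Banach space by the Hahn–Banach theorem. -/
theorem CompDistrib.exists_eq_comp_jet {n : ℕ} (v : CompDistrib n) :
    ∃ (S : Finset (TopologicalSpace.Compacts (E n) × ℕ)) (Λ : JetSpace S →L[ℂ] ℂ),
      ∀ f, v f = Λ (jet S f) := by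
  obtain ⟨S, C, -, hC⟩ := Seminorm.bound_of_continuous (smooth_withSeminorms n)
    ((normSeminorm ℂ ℂ).comp v.toLinearMap) (continuous_norm.comp v.continuous)
  have hS : ∀ f, (S.sup (smoothSeminorm n)) f ≤ ‖jet S f‖ := fun f =>
    Seminorm.finset_sup_apply_le (norm_nonneg _) fun p hp =>
      Real.iSup_le (fun y => JetSpace.norm_apply_le (jet S f) ⟨p, hp⟩ y) (norm_nonneg _)
  have hv : ∀ f, ‖v f‖ ≤ C * ‖jet S f‖ := fun f =>
    (hC f).trans (mul_le_mul_of_nonneg_left (hS f) C.2)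
  -- The bound makes `v` vanish on the kernel of `jet S`, so that `v` factors algebraically.
  have hker : v.toLinearMap ∈ LinearMap.range (jet S).dualMap := by
    rw [LinearMap.range_dualMap_eq_dualAnnihilator_ker, Submodule.mem_dualAnnihilator]
    intro f hf
    have := hv f
    rw [LinearMap.mem_ker.1 hf, norm_zero, mul_zero] at this
    exact norm_le_zero_iff.1 this
  obtain ⟨Λ₀, hΛ₀⟩ := hker
  have hΛ₀' : ∀ f, Λ₀ (jet S f) = v f := fun f => LinearMap.congr_fun hΛ₀ f
  let Λ₁ : StrongDual ℂ (LinearMap.range (jet S)) :=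
    (Λ₀.comp (LinearMap.range (jet S)).subtype).mkContinuous C (by
      rintro ⟨_, f, rfl⟩
      simpa [hΛ₀'] using hv f)
  obtain ⟨Λ, hΛ, -⟩ := exists_extension_norm_eq (LinearMap.range (jet S)) Λ₁
  refine ⟨S, Λ, fun f => ?_⟩
  rw [← hΛ₀' f]
  exact (hΛ ⟨jet S f, f, rfl⟩).symm

/-- The derivatives of the character `e^{-i x·ξ}`. -/
theorem iteratedFDeriv_expFn {n : ℕ} (ξ : E n) (k : ℕ) (y : E n) (m : Fin k → E n) :
    iteratedFDeriv ℝ k (expFn ξ).fn y m =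
      (∏ j, (-Complex.I * (⟪m j, ξ⟫ : ℝ))) * (expFn ξ).fn y := by
  induction k generalizing y with
  | zero => simp
  | succ k ih =>
    have hd : DifferentiableAt ℝ (iteratedFDeriv ℝ k (expFn ξ).fn) y :=
      ((expFn ξ).contDiff.differentiable_iteratedFDeriv
        (by exact_mod_cast WithTop.coe_lt_top _)) y
    have h1 := ((ContinuousMultilinearMap.apply ℝ (fun _ : Fin k => E n) ℂ
      (Fin.tail m)).hasFDerivAt.comp y hd.hasFDerivAt).fderiv
    have h2 : (⇑(ContinuousMultilinearMap.apply ℝ (fun _ : Fin k => E n) ℂ (Fin.tail m)) ∘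
        iteratedFDeriv ℝ k (expFn ξ).fn) = fun y =>
          (∏ j, (-Complex.I * (⟪Fin.tail m j, ξ⟫ : ℝ))) * (expFn ξ).fn y :=
      funext fun y => ih y (Fin.tail m)
    obtain ⟨l, hl⟩ : ∃ l : E n →L[ℝ] ℝ, ∀ x, l x = ⟪x, ξ⟫ :=
      ⟨(innerSL ℝ).flip ξ, fun _ => rfl⟩
    have h3 : HasFDerivAt (fun x : E n => (⟪x, ξ⟫ : ℝ)) l y :=
      (funext hl : ⇑l = _) ▸ l.hasFDerivAt
    have h4 := ((Complex.ofRealCLM.hasFDerivAt.comp y h3).const_mul (-Complex.I)).cexp.const_mul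
      (∏ j, (-Complex.I * (⟪Fin.tail m j, ξ⟫ : ℝ)))
    rw [iteratedFDeriv_succ_apply_left, Fin.prod_univ_succ]
    have h5 := DFunLike.congr_fun h1 (m 0)
    rw [h2] at h5
    refine h5.symm.trans ?_
    have h6 : (fun y => (∏ j, (-Complex.I * (⟪Fin.tail m j, ξ⟫ : ℝ))) * (expFn ξ).fn y) =
      fun y => (∏ j, (-Complex.I * (⟪Fin.tail m j, ξ⟫ : ℝ))) *
        Complex.exp (-Complex.I * (Complex.ofRealCLM ∘ fun x : E n => (⟪x, ξ⟫ : ℝ)) y) := rfl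
    rw [h6, h4.fderiv]
    simp [hl, Fin.tail, expFn, SmoothFn.fn_mk]
    ring

theorem norm_expFn {n : ℕ} (ξ y : E n) : ‖(expFn ξ).fn y‖ = 1 := by
  rw [expFn, SmoothFn.fn_mk, Complex.norm_exp]
  simp

theorem norm_iteratedFDeriv_expFn_le {n : ℕ} (ξ : E n) (k : ℕ) (y : E n) :
    ‖iteratedFDeriv ℝ k (expFn ξ).fn y‖ ≤ ‖ξ‖ ^ k := by
  refine ContinuousMultilinearMap.opNorm_le_bound (by positivity) fun m => ?_
  rw [iteratedFDeriv_expFn, norm_mul, norm_expFn, mul_one, norm_prod]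
  have : ‖ξ‖ ^ k * ∏ j, ‖m j‖ = ∏ j, (‖m j‖ * ‖ξ‖) := by
    rw [Finset.prod_mul_distrib, Finset.prod_const, Finset.card_univ, Fintype.card_fin, mul_comm]
  rw [this]
  refine Finset.prod_le_prod (fun _ _ => norm_nonneg _) fun j _ => ?_
  simpa using abs_real_inner_le_norm (m j) ξ

/-- The Fourier transform of a compactly supported distribution grows at most polynomially. -/
theorem exists_norm_distribFT_le {n : ℕ} (v : CompDistrib n) :
    ∃ (C : ℝ) (N : ℕ), 0 < C ∧ ∀ ξ, ‖distribFT v ξ‖ ≤ C * (1 + ‖ξ‖) ^ N := by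
  obtain ⟨S, Λ, hΛ⟩ := v.exists_eq_comp_jet
  refine ⟨‖Λ‖ + 1, S.sup Prod.snd, by positivity, fun ξ => ?_⟩
  rw [distribFT, hΛ]
  refine (Λ.le_opNorm _).trans (mul_le_mul (by linarith) ?_ (norm_nonneg _) (by positivity))
  refine JetSpace.norm_le (by positivity) fun p y => ?_
  rw [jet_apply]
  refine (norm_iteratedFDeriv_expFn_le ξ _ _).trans ?_
  refine (pow_le_pow_left₀ (norm_nonneg _) (by linarith) _).trans
    (pow_le_pow_right₀ (by linarith [norm_nonneg ξ]) ?_)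
  exact Finset.le_sup (f := Prod.snd) p.2

/-! ### The Fourier transform of a convolution -/

theorem funFT_eq_integral_expFn {n : ℕ} (f : E n → ℂ) (ξ : E n) :
    funFT f ξ = ∫ x, (expFn ξ).fn x * f x := rfl

theorem expFn_add {n : ℕ} (ξ x y : E n) :
    (expFn ξ).fn (x + y) = (expFn ξ).fn x * (expFn ξ).fn y := by
  simp only [expFn, SmoothFn.fn_mk, ← Complex.exp_add, inner_add_left]
  push_cast
  ring_nf

/-- Passage from Mathlib's normalization `e^{-2πi x·ξ}` of the Fourier transform to `e^{-i x·ξ}`. -/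
theorem fourier_eq_integral_expFn {n : ℕ} {F : Type*} [NormedAddCommGroup F] [NormedSpace ℂ F]
    (f : E n → F) (ξ : E n) :
    𝓕 f ((2 * Real.pi)⁻¹ • ξ) = ∫ x, (expFn ξ).fn x • f x := by
  rw [Real.fourier_eq']
  refine integral_congr_ae (Filter.Eventually.of_forall fun x => ?_)
  have hpi : (Real.pi : ℂ) ≠ 0 := by exact_mod_cast Real.pi_ne_zero
  simp only [expFn, SmoothFn.fn_mk, inner_smul_right]
  congr 2
  push_cast
  field_simp

theorem funFT_iteratedFDeriv {n : ℕ} (ρ : 𝓢(E n, ℂ)) (ξ : E n) (k : ℕ) (m : Fin k → E n) :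
    funFT (fun x => iteratedFDeriv ℝ k ρ x m) ξ =
      (∏ j, (Complex.I * (⟪m j, ξ⟫ : ℝ))) * funFT ρ ξ := by
  have hint : ∀ j : ℕ, Integrable (iteratedFDeriv ℝ j ρ) := fun j => by
    refine (ρ.integrable_pow_mul_iteratedFDeriv volume 0 j).mono'
      ((ρ.smooth ⊤).continuous_iteratedFDeriv (by exact_mod_cast le_top)).aestronglyMeasurable
      (Filter.Eventually.of_forall fun x => by simp)
  have h := congrFun (Real.fourier_iteratedFDeriv (N := ⊤) (ρ.smooth ⊤) (fun j _ => hint j)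
    (n := k) le_top) ((2 * Real.pi)⁻¹ • ξ)
  have h' := DFunLike.congr_fun h m
  rw [VectorFourier.fourierPowSMulRight_apply, fourier_eq_integral_expFn,
    fourier_eq_integral_expFn] at h'
  have hi : Integrable fun x => (expFn ξ).fn x • iteratedFDeriv ℝ k ρ x := by
    refine (hint k).norm.mono' (((expFn ξ).contDiff.continuous.smul
      ((ρ.smooth ⊤).continuous_iteratedFDeriv (by exact_mod_cast le_top))).aestronglyMeasurable)
      (Filter.Eventually.of_forall fun x => by rw [norm_smul, norm_expFn, one_mul])
  have h1 := (ContinuousMultilinearMap.apply ℝ (fun _ : Fin k => E n) ℂ m).integral_comp_comm hi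
  rw [funFT_eq_integral_expFn, funFT_eq_integral_expFn]
  refine Eq.trans ?_ ((h1.trans h').trans ?_)
  · rfl
  · have hpi : (Real.pi : ℂ) ≠ 0 := by exact_mod_cast Real.pi_ne_zero
    simp only [smul_eq_mul, Complex.real_smul, ← mul_assoc]
    congr 1
    have : ∀ j, (Complex.I * (⟪m j, ξ⟫ : ℝ)) = (-(2 * Real.pi * Complex.I)) *
        (((-innerSL ℝ ((2 * Real.pi)⁻¹ • ξ)) (m j) : ℝ) : ℂ) := by
      intro j
      simp only [neg_apply, innerSL_apply_apply, inner_smul_left,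
        real_inner_comm]
      push_cast
      simp
      field_simp
    rw [Finset.prod_congr rfl fun j _ => this j, Finset.prod_mul_distrib, Finset.prod_const,
      Finset.card_univ, Fintype.card_fin]
    push_cast
    rfl

/-- The function `y ↦ ρ(x - y)`. -/
noncomputable def reflTranslate {n : ℕ} (ρ : SmoothFn n) (x : E n) : SmoothFn n :=
  SmoothFn.mk (fun y => ρ.fn (x - y)) (ρ.contDiff.comp (contDiff_const.sub contDiff_id))

theorem iteratedFDeriv_reflTranslate {n : ℕ} (ρ : SmoothFn n) (x y : E n) (k : ℕ) :
    iteratedFDeriv ℝ k (reflTranslate ρ x).fn y =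
      (iteratedFDeriv ℝ k ρ.fn (x - y)).compContinuousLinearMap
        fun _ => -ContinuousLinearMap.id ℝ (E n) := by
  have hs : ContDiff ℝ ∞ fun z => ρ.fn (z + x) := ρ.contDiff.comp (contDiff_id.add contDiff_const)
  have h := (-ContinuousLinearMap.id ℝ (E n)).iteratedFDeriv_comp_right hs y
    (i := k) (by exact_mod_cast le_top)
  rw [iteratedFDeriv_comp_add_right] at h
  have h1 : (reflTranslate ρ x).fn =
      (fun z => ρ.fn (z + x)) ∘ (-ContinuousLinearMap.id ℝ (E n)) := by
    funext z
    simp [reflTranslate, SmoothFn.fn_mk, sub_eq_neg_add]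
  rw [h1, h]
  simp [sub_eq_neg_add]

theorem continuous_jet_reflTranslate {n : ℕ} (S : Finset (TopologicalSpace.Compacts (E n) × ℕ))
    (ρ : SmoothFn n) : Continuous fun x => jet S (reflTranslate ρ x) := by
  refine continuous_pi fun p => ContinuousMap.continuous_of_continuous_uncurry _ ?_
  have h : Continuous fun q : E n × p.1.1 =>
      ContinuousMultilinearMap.compContinuousLinearMapL (F := ℂ)
        (fun _ : Fin p.1.2 => -ContinuousLinearMap.id ℝ (E n))
        (iteratedFDeriv ℝ p.1.2 ρ.fn (q.1 - q.2)) :=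
    (ContinuousLinearMap.continuous _).comp
      ((ρ.contDiff.continuous_iteratedFDeriv (by exact_mod_cast le_top)).comp (by fun_prop))
  refine h.congr fun q => ?_
  exact (iteratedFDeriv_reflTranslate ρ q.1 q.2 p.1.2).symm

theorem norm_iteratedFDeriv_reflTranslate_le {n : ℕ} (ρ : SmoothFn n) (x y : E n) (k : ℕ) :
    ‖iteratedFDeriv ℝ k (reflTranslate ρ x).fn y‖ ≤ ‖iteratedFDeriv ℝ k ρ.fn (x - y)‖ := by
  rw [iteratedFDeriv_reflTranslate]
  refine ContinuousMultilinearMap.opNorm_le_bound (norm_nonneg _) fun m => ?_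
  simpa using (iteratedFDeriv ℝ k ρ.fn (x - y)).le_opNorm fun j => -m j

/-- On a compact set of `y`, the derivatives of `ρ` at `x - y` decay like `(1 + |x|)^{-(n+1)}`. -/
theorem integrable_jet_reflTranslate {n : ℕ} (S : Finset (TopologicalSpace.Compacts (E n) × ℕ))
    (ρ : SmoothFn n) (g : 𝓢(E n, ℂ)) (hg : ⇑g = ρ.fn) :
    Integrable fun x => jet S (reflTranslate ρ x) := by
  have hb : ∀ p : S, ∃ B : ℝ, 0 ≤ B ∧ ∀ x y, ‖jet S (reflTranslate ρ x) p y‖ ≤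
      B * (1 + ‖x‖) ^ (-((n + 1 : ℕ) : ℝ)) := by
    intro p
    obtain ⟨R, hR⟩ := p.1.1.isCompact.isBounded.exists_norm_le
    set A : ℝ := 2 ^ (n + 1) * (Finset.Iic ((n + 1, p.1.2) : ℕ × ℕ)).sup
      (fun m => SchwartzMap.seminorm ℝ m.1 m.2) g with hA
    have hA0 : 0 ≤ A := mul_nonneg (by positivity) (apply_nonneg _ _)
    refine ⟨(1 + |R|) ^ (n + 1) * A, by positivity, fun x y => ?_⟩
    rw [jet_apply]
    refine (norm_iteratedFDeriv_reflTranslate_le ρ x y _).trans ?_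
    rw [Real.rpow_neg (by positivity), Real.rpow_natCast, ← div_eq_mul_inv,
      le_div_iff₀ (by positivity)]
    have h1 := SchwartzMap.one_add_le_sup_seminorm_apply (𝕜 := ℝ) (m := (n + 1, p.1.2))
      (le_refl (n + 1)) (le_refl p.1.2) g (x - y)
    rw [hg, ← hA] at h1
    have h2 : 1 + ‖x‖ ≤ (1 + |R|) * (1 + ‖x - y‖) := by
      have h3 : ‖x‖ ≤ ‖x - y‖ + ‖(y : E n)‖ := by
        simpa using norm_add_le (x - (y : E n)) y
      have h4 : ‖(y : E n)‖ ≤ |R| := (hR y y.2).trans (le_abs_self R)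
      nlinarith [mul_nonneg (abs_nonneg R) (norm_nonneg (x - (y : E n)))]
    calc ‖iteratedFDeriv ℝ p.1.2 ρ.fn (x - y)‖ * (1 + ‖x‖) ^ (n + 1)
        ≤ ‖iteratedFDeriv ℝ p.1.2 ρ.fn (x - y)‖ * ((1 + |R|) * (1 + ‖x - y‖)) ^ (n + 1) := by
          gcongr
      _ = (1 + |R|) ^ (n + 1) *
          ((1 + ‖x - y‖) ^ (n + 1) * ‖iteratedFDeriv ℝ p.1.2 ρ.fn (x - y)‖) := by rw [mul_pow]; ring
      _ ≤ _ := by gcongr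
  choose B hB0 hB using hb
  have hi : Integrable fun x : E n => (∑ p, B p) * (1 + ‖x‖) ^ (-((n + 1 : ℕ) : ℝ)) :=
    (integrable_one_add_norm (by simp)).const_mul _
  refine hi.mono' (continuous_jet_reflTranslate S ρ).aestronglyMeasurable
    (Filter.Eventually.of_forall fun x => ?_)
  have hx : (0 : ℝ) ≤ (1 + ‖x‖) ^ (-((n + 1 : ℕ) : ℝ)) := by positivity
  refine JetSpace.norm_le (mul_nonneg (Finset.sum_nonneg fun p _ => hB0 p) hx)
    fun p y => (hB p x y).trans (mul_le_mul_of_nonneg_right ?_ hx)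
  exact Finset.single_le_sum (fun p _ => hB0 p) (Finset.mem_univ p)

theorem integrable_distribConv {n : ℕ} (v : CompDistrib n) (ρ : SmoothFn n) (g : 𝓢(E n, ℂ))
    (hg : ⇑g = ρ.fn) : Integrable (distribConv v ρ) := by
  obtain ⟨S, Λ, hΛ⟩ := v.exists_eq_comp_jet
  refine (Λ.integrable_comp (integrable_jet_reflTranslate S ρ g hg)).congr
    (Filter.Eventually.of_forall fun x => ?_)
  exact (hΛ _).symm

/-- The exchange formula: the Fourier transform of `v ∗ ρ` is the product of those of `v` and of the
Schwartz function `ρ`. -/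
theorem funFT_distribConv {n : ℕ} (v : CompDistrib n) (ρ : SmoothFn n) (g : 𝓢(E n, ℂ))
    (hg : ⇑g = ρ.fn) (ξ : E n) :
    funFT (distribConv v ρ) ξ = distribFT v ξ * funFT ρ.fn ξ := by
  obtain ⟨S, Λ, hΛ⟩ := v.exists_eq_comp_jet
  have hi := integrable_jet_reflTranslate S ρ g hg
  have hi' : Integrable fun x => (expFn ξ).fn x • jet S (reflTranslate ρ x) := by
    refine hi.norm.mono' ((expFn ξ).contDiff.continuous.smul
      (continuous_jet_reflTranslate S ρ)).aestronglyMeasurable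
      (Filter.Eventually.of_forall fun x => by rw [norm_smul, norm_expFn, one_mul])
  -- Vector-valued integration reduces the formula to the values of the jets, where it is the
  -- Fourier transform of a derivative of `ρ`, translated by `y`.
  have hJ : ∫ x, (expFn ξ).fn x • jet S (reflTranslate ρ x) = funFT ρ.fn ξ • jet S (expFn ξ) := by
    funext p
    ext y m
    have h1 := (JetSpace.eval p y m).integral_comp_comm hi'
    refine h1.symm.trans ?_
    have h2 : ∀ x, JetSpace.eval p y m ((expFn ξ).fn x • jet S (reflTranslate ρ x)) =
        (expFn ξ).fn x * iteratedFDeriv ℝ p.1.2 ρ.fn (x - y) fun j => -m j := by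
      intro x
      change (expFn ξ).fn x * iteratedFDeriv ℝ p.1.2 (reflTranslate ρ x).fn y m = _
      rw [iteratedFDeriv_reflTranslate]
      simp
    change _ = funFT ρ.fn ξ * iteratedFDeriv ℝ p.1.2 (expFn ξ).fn y m
    simp only [h2]
    rw [← integral_add_right_eq_self _ (y : E n)]
    simp only [expFn_add, add_sub_cancel_right, mul_right_comm _ ((expFn ξ).fn (y : E n))]
    rw [integral_mul_const, ← funFT_eq_integral_expFn, ← hg, funFT_iteratedFDeriv,
      iteratedFDeriv_expFn]
    simp only [inner_neg_left, Complex.ofReal_neg, mul_neg, neg_mul]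
    ring
  have h3 : ∀ x, (expFn ξ).fn x * distribConv v ρ x =
      Λ ((expFn ξ).fn x • jet S (reflTranslate ρ x)) := by
    intro x
    rw [map_smul, ← hΛ]
    rfl
  rw [funFT_eq_integral_expFn]
  simp only [h3]
  rw [Λ.integral_comp_comm hi', hJ, map_smul, ← hΛ, smul_eq_mul, mul_comm]
  rfl

/-! ### The Fourier transform of the mollifiers -/

section Mollifier

variable {n : ℕ} {s : ℝ} (φ : GSMollifier n s) (χ : GevreyCutoff n s)

/-- The mollifier `ρ_w` is a Schwartz function: for `w = 1`, where the cut-off degenerates, it is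
`φ` itself, and otherwise it has compact support. -/
theorem exists_schwartzMap_eq_rho {w : ℝ} (hw : 0 < w) :
    ∃ g : 𝓢(E n, ℂ), ⇑g = (rho φ χ w).fn := by
  by_cases hl : Real.log w = 0
  · obtain rfl := Real.eq_one_of_pos_of_log_eq_zero hw hl
    obtain ⟨g, hg⟩ := φ.exists_schwartzMap_eq
    refine ⟨g, hg.trans (funext fun x => ?_)⟩
    simp [rho, SmoothFn.fn_mk, χ.eq_one]
  · have hl' : 0 < |Real.log w| := abs_pos.2 hl
    have hc : HasCompactSupport (rho φ χ w).fn := by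
      refine HasCompactSupport.intro (isCompact_closedBall 0 (2 / |Real.log w|)) fun x hx => ?_
      rw [mem_closedBall_zero_iff, not_le, div_lt_iff₀ hl'] at hx
      have : χ.fn (|Real.log w| • x) = 0 := χ.eq_zero _ (by
        rw [norm_smul, Real.norm_eq_abs, abs_abs, mul_comm]
        exact hx.le)
      simp [rho, SmoothFn.fn_mk, this]
    exact ⟨hc.toSchwartzMap (rho φ χ w).contDiff, rfl⟩

/-- The substitution `x = w y` in the Fourier integral of `ρ_w`. -/
theorem funFT_rho {w : ℝ} (hw : 0 < w) (ξ : E n) :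
    funFT (rho φ χ w).fn ξ =
      ∫ y, ((expFn (w • ξ)).fn y * χ.fn ((w * |Real.log w|) • y)) * φ.fn y := by
  have h := MeasureTheory.Measure.integral_comp_inv_smul (volume : Measure (E n))
    (fun y => ((expFn (w • ξ)).fn y * χ.fn ((w * |Real.log w|) • y)) * φ.fn y) w
  rw [finrank_euclideanSpace_fin, abs_of_pos (pow_pos hw n)] at h
  rw [← inv_smul_smul₀ (pow_pos hw n).ne' (∫ y, _), ← h, ← integral_smul]
  refine integral_congr_ae (Filter.Eventually.of_forall fun x => ?_)
  have h1 : (w * |Real.log w|) • w⁻¹ • x = |Real.log w| • x := by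
    rw [smul_smul]
    congr 1
    field_simp
  have h2 : (expFn (w • ξ)).fn (w⁻¹ • x) = (expFn ξ).fn x := by
    simp only [expFn, SmoothFn.fn_mk, inner_smul_left, inner_smul_right]
    congr 3
    simp
    field_simp
  have h3 : (expFn ξ).fn x = Complex.exp (-Complex.I * (⟪x, ξ⟫ : ℝ)) := rfl
  simp only [h1, h2, h3, rho, SmoothFn.fn_mk, Complex.real_smul]
  ring

theorem integrable_norm_pow_mul (k : ℕ) : Integrable fun y => ‖y‖ ^ k * ‖φ.fn y‖ := by
  simpa using integrable_norm_pow_mul_iteratedFDeriv φ k 0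

theorem integrable_mul_of_norm_le {a : E n → ℂ} (ha : Continuous a) {C : ℝ} {k : ℕ}
    (h : ∀ y, ‖a y‖ ≤ C * ‖y‖ ^ k) : Integrable fun y => a y * φ.fn y := by
  refine ((integrable_norm_pow_mul φ k).const_mul C).mono'
    (ha.mul φ.contDiff.continuous).aestronglyMeasurable (Filter.Eventually.of_forall fun y => ?_)
  rw [norm_mul, ← mul_assoc]
  exact mul_le_mul_of_nonneg_right (h y) (norm_nonneg _)

theorem abs_mpow_le (β : Fin n → ℕ) (y : E n) : |mpow y β| ≤ ‖y‖ ^ mlen β := by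
  rw [mpow, Finset.abs_prod, mlen, ← Finset.prod_pow_eq_pow_sum]
  refine Finset.prod_le_prod (fun _ _ => abs_nonneg _) fun i _ => ?_
  rw [abs_pow]
  exact pow_le_pow_left₀ (abs_nonneg _) (PiLp.norm_apply_le y i) _

theorem inner_pow_eq_sum_mpow (y η : E n) (k : ℕ) :
    ⟪y, η⟫ ^ k = ∑ β ∈ Finset.univ.piAntidiag k,
      (Nat.multinomial Finset.univ β * mpow η β) * mpow y β := by
  rw [PiLp.inner_apply, Finset.sum_pow_eq_sum_piAntidiag]
  refine Finset.sum_congr rfl fun β _ => ?_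
  simp [mpow, mul_pow, Finset.prod_mul_distrib, mul_assoc]

theorem integral_inner_pow_mul (η : E n) {k : ℕ} (hk : k ≠ 0) :
    ∫ y, ((⟪y, η⟫ : ℝ) : ℂ) ^ k * φ.fn y = 0 := by
  have h : ∀ y, ((⟪y, η⟫ : ℝ) : ℂ) ^ k * φ.fn y = ∑ β ∈ Finset.univ.piAntidiag k,
      ((Nat.multinomial Finset.univ β * mpow η β : ℝ) : ℂ) * ((mpow y β : ℂ) * φ.fn y) := by
    intro y
    rw [← Complex.ofReal_pow, inner_pow_eq_sum_mpow, Complex.ofReal_sum, Finset.sum_mul]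
    refine Finset.sum_congr rfl fun β _ => ?_
    push_cast
    ring
  simp only [h]
  have hint : ∀ β : Fin n → ℕ, Integrable fun y => (mpow y β : ℂ) * φ.fn y := fun β =>
    integrable_mul_of_norm_le φ (C := 1) (k := mlen β)
      (Complex.continuous_ofReal.comp (continuous_mpow β)) fun y => by
        simpa using abs_mpow_le β y
  rw [integral_finsetSum _ fun β _ => (hint β).const_mul _]
  refine Finset.sum_eq_zero fun β hβ => ?_
  have hβ0 : β ≠ 0 := by
    rintro rfl
    exact hk (by simpa using (Finset.mem_piAntidiag.1 hβ).1.symm)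
  rw [integral_const_mul, φ.moment_eq_zero β hβ0, mul_zero]

/-- The Taylor polynomial of degree `q` of the character `e^{-i y·η}` in the variable `y·η`. -/
noncomputable def expTaylor (q : ℕ) (η y : E n) : ℂ :=
  ∑ k ∈ Finset.range (q + 1), (-Complex.I * (⟪y, η⟫ : ℝ)) ^ k / (k.factorial : ℂ)

theorem integrable_expTaylor_mul (q : ℕ) (η : E n) :
    Integrable fun y => expTaylor q η y * φ.fn y := by
  simp only [expTaylor, Finset.sum_mul]
  refine integrable_finsetSum _ fun k _ => integrable_mul_of_norm_le φ (C := ‖η‖ ^ k) (k := k)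
    (by fun_prop) fun y => ?_
  rw [norm_div, norm_pow, norm_mul, norm_neg, Complex.norm_I, one_mul, Complex.norm_real,
    Complex.norm_natCast, ← mul_pow]
  refine (div_le_self (by positivity) (by exact_mod_cast k.factorial_pos)).trans
    (pow_le_pow_left₀ (norm_nonneg _) ?_ k)
  rw [mul_comm]
  exact abs_real_inner_le_norm y η

/-- All moments of positive order vanish, so that only the constant term contributes. -/
theorem integral_expTaylor_mul (q : ℕ) (η : E n) : ∫ y, expTaylor q η y * φ.fn y = 1 := by
  have hterm : ∀ k : ℕ, (fun y => (-Complex.I * (⟪y, η⟫ : ℝ)) ^ k / (k.factorial : ℂ) * φ.fn y) =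
      fun y => ((-Complex.I) ^ k / (k.factorial : ℂ)) * (((⟪y, η⟫ : ℝ) : ℂ) ^ k * φ.fn y) := by
    intro k
    funext y
    rw [mul_pow]
    ring
  have hint : ∀ k : ℕ, Integrable fun y => ((⟪y, η⟫ : ℝ) : ℂ) ^ k * φ.fn y := fun k => by
    refine integrable_mul_of_norm_le φ (C := ‖η‖ ^ k) (k := k) (by fun_prop) fun y => ?_
    rw [norm_pow, Complex.norm_real, ← mul_pow, mul_comm]
    exact pow_le_pow_left₀ (norm_nonneg _) (abs_real_inner_le_norm y η) k
  simp only [expTaylor, Finset.sum_mul]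
  rw [integral_finsetSum _ fun k _ => by rw [hterm k]; exact (hint k).const_mul _,
    Finset.sum_eq_single 0]
  · simpa using φ.integral_eq_one
  · intro k _ hk
    rw [hterm k, integral_const_mul, integral_inner_pow_mul φ η hk, mul_zero]
  · simp

/-- The Taylor remainder bound, uniform in `y·η`: where `|y·η| ≥ 1`, every term of the polynomial and
the character itself are dominated by `|y·η|^{q+1}`. -/
theorem norm_expFn_sub_expTaylor_le (q : ℕ) (η y : E n) :
    ‖(expFn η).fn y - expTaylor q η y‖ ≤ 4 * (‖y‖ * ‖η‖) ^ (q + 1) := by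
  set z : ℂ := -Complex.I * (⟪y, η⟫ : ℝ) with hz
  have hzn : ‖z‖ = |(⟪y, η⟫ : ℝ)| := by simp [hz]
  have hexp : ‖Complex.exp z‖ = 1 := norm_expFn η y
  have he : Real.exp 1 ≤ 3 := by linarith [Real.exp_one_lt_d9]
  suffices h : ‖Complex.exp z - ∑ k ∈ Finset.range (q + 1), z ^ k / (k.factorial : ℂ)‖ ≤
      4 * ‖z‖ ^ (q + 1) from
    h.trans (mul_le_mul_of_nonneg_left (pow_le_pow_left₀ (norm_nonneg _)
      (hzn.trans_le (abs_real_inner_le_norm y η)) _) (by norm_num))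
  rcases le_total ‖z‖ 1 with h1 | h1
  · refine (Complex.norm_exp_sub_sum_le_norm_mul_exp z (q + 1)).trans ?_
    rw [mul_comm]
    exact mul_le_mul_of_nonneg_right ((Real.exp_le_exp.2 h1).trans (by linarith)) (by positivity)
  · refine (norm_sub_le _ _).trans ?_
    have h2 : ‖∑ k ∈ Finset.range (q + 1), z ^ k / (k.factorial : ℂ)‖ ≤
        ‖z‖ ^ (q + 1) * Real.exp 1 := by
      refine (norm_sum_le _ _).trans ?_
      refine le_trans ?_ (mul_le_mul_of_nonneg_left
        (Real.sum_le_exp_of_nonneg zero_le_one (q + 1)) (by positivity))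
      rw [Finset.mul_sum]
      refine Finset.sum_le_sum fun k hk => ?_
      rw [norm_div, norm_pow, Complex.norm_natCast, one_pow, mul_one_div]
      exact div_le_div_of_nonneg_right (pow_le_pow_right₀ h1 (Finset.mem_range.1 hk).le)
        (by positivity)
    have h3 : 1 ≤ ‖z‖ ^ (q + 1) := one_le_pow₀ h1
    rw [hexp]
    nlinarith

/-- The left-hand side vanishes on the unit ball and is at most `1` outside it. -/
theorem abs_cutoff_sub_one_le (k : ℕ) (x : E n) : |χ.fn x - 1| ≤ ‖x‖ ^ k := by
  rcases le_total ‖x‖ 1 with h | h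
  · rw [χ.eq_one x h, sub_self, abs_zero]
    positivity
  · refine le_trans ?_ (one_le_pow₀ h)
    rw [abs_le]
    constructor <;> linarith [χ.nonneg x, χ.le_one x]

theorem mul_abs_log_sq_le {w : ℝ} (hw : 0 < w) (hw1 : w ≤ 1) : (w * |Real.log w|) ^ 2 ≤ 4 * w := by
  have hr : 0 < √w := Real.sqrt_pos.2 hw
  have h1 : |Real.log w| ≤ 2 * (√w)⁻¹ := by
    rw [abs_of_nonpos (Real.log_nonpos hw.le hw1), ← Real.log_inv]
    -- `log x ≤ x - 1` is applied to `x = w^{-1/2}`.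
    have : Real.log w⁻¹ = 2 * Real.log (√w)⁻¹ := by
      rw [Real.log_inv, Real.log_inv, Real.log_sqrt hw.le]
      ring
    rw [this]
    have := Real.log_le_sub_one_of_pos (inv_pos.2 hr)
    linarith
  have h2 : w * |Real.log w| ≤ 2 * √w := by
    refine (mul_le_mul_of_nonneg_left h1 hw.le).trans (le_of_eq ?_)
    have h4 := Real.mul_self_sqrt hw.le
    field_simp
    nlinarith
  calc (w * |Real.log w|) ^ 2 ≤ (2 * √w) ^ 2 := pow_le_pow_left₀ (by positivity) h2 2
    _ = 4 * w := by rw [mul_pow, Real.sq_sqrt hw.le]; norm_num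

/-- For `w ≤ 1`, the Taylor polynomial of the character is subtracted under the integral, which
changes it by `1`; the cut-off contributes an error `O((w |log w|)^{2q}) = O(w^q)`.
For `w ≥ 1` both terms on the left are bounded. -/
theorem exists_norm_funFT_rho_sub_one_le (q : ℕ) :
    ∃ C : ℝ, 0 < C ∧ ∀ w : ℝ, 0 < w → ∀ ξ : E n,
      ‖funFT (rho φ χ w).fn ξ - 1‖ ≤ C * w ^ q * (1 + ‖ξ‖) ^ (q + 1) := by
  have hi0 := integrable_norm_pow_mul φ 0
  have hi1 := integrable_norm_pow_mul φ (2 * q)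
  have hi2 := integrable_norm_pow_mul φ (q + 1)
  set A₀ := ∫ y, ‖y‖ ^ 0 * ‖φ.fn y‖ with hA₀
  set A₁ := ∫ y, ‖y‖ ^ (2 * q) * ‖φ.fn y‖ with hA₁
  set A₂ := ∫ y, ‖y‖ ^ (q + 1) * ‖φ.fn y‖ with hA₂
  have hA₀0 : 0 ≤ A₀ := integral_nonneg fun y => by positivity
  have hA₁0 : 0 ≤ A₁ := integral_nonneg fun y => by positivity
  have hA₂0 : 0 ≤ A₂ := integral_nonneg fun y => by positivity
  refine ⟨A₀ + 4 ^ q * A₁ + 4 * A₂ + 1, by positivity, fun w hw ξ => ?_⟩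
  have hξ : 1 ≤ (1 + ‖ξ‖) ^ (q + 1) := one_le_pow₀ (by linarith [norm_nonneg ξ])
  have hcut : ∀ y : E n, ‖(χ.fn ((w * |Real.log w|) • y) : ℂ)‖ ≤ 1 := fun y => by
    rw [Complex.norm_real, Real.norm_of_nonneg (χ.nonneg _)]
    exact χ.le_one _
  have hcont : Continuous fun y : E n =>
      (expFn (w • ξ)).fn y * (χ.fn ((w * |Real.log w|) • y) : ℂ) :=
    (expFn (w • ξ)).contDiff.continuous.mul (Complex.continuous_ofReal.comp
      (χ.contDiff.continuous.comp (continuous_const_smul _)))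
  have hle : ∀ y : E n, ‖(expFn (w • ξ)).fn y * (χ.fn ((w * |Real.log w|) • y) : ℂ)‖ ≤ 1 :=
    fun y => by
      rw [norm_mul, norm_expFn, one_mul]
      exact hcut y
  rw [funFT_rho φ χ hw]
  rcases le_total 1 w with hw1 | hw1
  · have h1 : ‖∫ y, ((expFn (w • ξ)).fn y * χ.fn ((w * |Real.log w|) • y)) * φ.fn y‖ ≤ A₀ := by
      refine norm_integral_le_of_norm_le hi0 (Filter.Eventually.of_forall fun y => ?_)
      rw [norm_mul, pow_zero]
      exact mul_le_mul_of_nonneg_right (hle y) (norm_nonneg _)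
    have hwq : 1 ≤ w ^ q * (1 + ‖ξ‖) ^ (q + 1) := one_le_mul_of_one_le_of_one_le (one_le_pow₀ hw1) hξ
    refine (norm_sub_le _ _).trans ?_
    rw [norm_one, mul_assoc]
    calc _ ≤ (A₀ + 4 ^ q * A₁ + 4 * A₂ + 1) * 1 := by
          have : 0 ≤ 4 ^ q * A₁ := by positivity
          linarith
      _ ≤ _ := mul_le_mul_of_nonneg_left hwq (by positivity)
  · have hI : Integrable fun y =>
        ((expFn (w • ξ)).fn y * χ.fn ((w * |Real.log w|) • y)) * φ.fn y :=
      integrable_mul_of_norm_le φ hcont (C := 1) (k := 0) fun y => by simpa using hle y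
    have hT := integral_expTaylor_mul φ q (w • ξ)
    rw [show (1 : ℂ) = _ from hT.symm, ← integral_sub hI (integrable_expTaylor_mul φ q _)]
    set B := w ^ q * (1 + ‖ξ‖) ^ (q + 1) with hB
    have hB0 : 0 ≤ B := by positivity
    have hbound : ∀ y : E n, ‖((expFn (w • ξ)).fn y * χ.fn ((w * |Real.log w|) • y)) * φ.fn y -
        expTaylor q (w • ξ) y * φ.fn y‖ ≤
        (4 ^ q * B) * (‖y‖ ^ (2 * q) * ‖φ.fn y‖) + (4 * B) * (‖y‖ ^ (q + 1) * ‖φ.fn y‖) := by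
      intro y
      have hsplit : ((expFn (w • ξ)).fn y * χ.fn ((w * |Real.log w|) • y)) * φ.fn y -
          expTaylor q (w • ξ) y * φ.fn y =
          ((expFn (w • ξ)).fn y * ((χ.fn ((w * |Real.log w|) • y) - 1 : ℝ) : ℂ) +
            ((expFn (w • ξ)).fn y - expTaylor q (w • ξ) y)) * φ.fn y := by
        push_cast
        ring
      have h1 : ‖(expFn (w • ξ)).fn y * ((χ.fn ((w * |Real.log w|) • y) - 1 : ℝ) : ℂ)‖ ≤
          4 ^ q * B * ‖y‖ ^ (2 * q) := by
        rw [norm_mul, norm_expFn, one_mul, Complex.norm_real]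
        refine (abs_cutoff_sub_one_le χ (2 * q) _).trans ?_
        rw [norm_smul, mul_pow, Real.norm_of_nonneg (by positivity)]
        refine mul_le_mul_of_nonneg_right ?_ (by positivity)
        calc (w * |Real.log w|) ^ (2 * q) = ((w * |Real.log w|) ^ 2) ^ q := pow_mul _ _ _
          _ ≤ (4 * w) ^ q := pow_le_pow_left₀ (by positivity) (mul_abs_log_sq_le hw hw1) q
          _ = 4 ^ q * (w ^ q * 1) := by rw [mul_pow, mul_one]
          _ ≤ 4 ^ q * B := by
            rw [hB]
            gcongr
      have h2 : ‖(expFn (w • ξ)).fn y - expTaylor q (w • ξ) y‖ ≤ 4 * B * ‖y‖ ^ (q + 1) := by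
        refine (norm_expFn_sub_expTaylor_le q _ y).trans ?_
        rw [norm_smul, Real.norm_of_nonneg hw.le, mul_pow, mul_pow, mul_comm (‖y‖ ^ (q + 1)),
          ← mul_assoc]
        refine mul_le_mul_of_nonneg_right (mul_le_mul_of_nonneg_left ?_ (by norm_num))
          (by positivity)
        refine mul_le_mul (pow_le_pow_of_le_one hw.le hw1 q.le_succ)
          (pow_le_pow_left₀ (norm_nonneg _) (by linarith) _) (by positivity) (by positivity)
      rw [hsplit, norm_mul]
      refine (mul_le_mul_of_nonneg_right ((norm_add_le _ _).trans (add_le_add h1 h2))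
        (norm_nonneg _)).trans (le_of_eq (by ring))
    refine (norm_integral_le_of_norm_le ((hi1.const_mul (4 ^ q * B)).add (hi2.const_mul (4 * B)))
      (Filter.Eventually.of_forall hbound)).trans ?_
    rw [integral_add' (hi1.const_mul _) (hi2.const_mul _), integral_const_mul, integral_const_mul,
      ← hA₁, ← hA₂, mul_assoc _ (w ^ q), ← hB]
    nlinarith [mul_nonneg hB0 hA₀0]

end Mollifier

theorem exists_pow_le_exp_rpow {s : ℝ} (hs : 0 < s) (M : ℕ) :
    ∃ c : ℝ, 0 < c ∧ ∀ t : ℝ, 1 ≤ t → t ^ M ≤ c * Real.exp (t ^ (1 / s)) := by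
  -- With `u = t^{1/s}` one has `t^M = u^{sM} ≤ u^K ≤ K! e^u`.
  set K := ⌈s * M⌉₊
  refine ⟨(K.factorial : ℝ), by positivity, fun t ht => ?_⟩
  have ht0 : 0 ≤ t := zero_le_one.trans ht
  set u := t ^ (1 / s) with hu
  have hu1 : 1 ≤ u := Real.one_le_rpow ht (by positivity)
  have htu : t ^ M = u ^ (s * M) := by
    rw [hu, ← Real.rpow_mul ht0, ← Real.rpow_natCast]
    congr 1
    field_simp
  calc t ^ M = u ^ (s * M) := htu
    _ ≤ u ^ (K : ℝ) := Real.rpow_le_rpow_of_exponent_le hu1 (Nat.le_ceil _)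
    _ = u ^ K := Real.rpow_natCast _ _
    _ ≤ (K.factorial : ℝ) * Real.exp u := by
      rw [mul_comm, ← div_le_iff₀ (by positivity)]
      exact Real.pow_div_factorial_le_exp u (zero_le_one.trans hu1) K

theorem one_le_bracket {n : ℕ} (ξ : E n) : 1 ≤ bracket ξ :=
  Real.one_le_sqrt.2 (by nlinarith [norm_nonneg ξ])

theorem one_add_norm_le_two_mul_bracket {n : ℕ} (ξ : E n) : 1 + ‖ξ‖ ≤ 2 * bracket ξ := by
  have h : ‖ξ‖ ≤ bracket ξ := Real.le_sqrt_of_sq_le (by linarith)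
  linarith [one_le_bracket ξ]

end GevreyReg

theorem mainTheorem5 (n : ℕ) (s : ℝ) (hs : 1 < s)
    (φ : GSMollifier n s) (χ : GevreyCutoff n s)
    (ω : ℝ → ℝ) (hω : ∀ ε ∈ Set.Ioc (0 : ℝ) 1, 0 < ω ε)
    (v : CompDistrib n) :
    (∀ ε ∈ Set.Ioc (0 : ℝ) 1,
      MeasureTheory.Integrable (distribConv v (rho φ χ (ω ε)))) ∧
    ∃ ν : ℝ, 0 < ν ∧ ∃ C : ℝ, 0 < C ∧ ∀ q : ℕ, ∃ c : ℝ, 0 < c ∧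
      ∀ ξ : E n, ∀ ε ∈ Set.Ioc (0 : ℝ) 1,
        ‖funFT (distribConv v (rho φ χ (ω ε))) ξ - distribFT v ξ‖
          ≤ c * C * ω ε ^ q * Real.exp (ν * bracket ξ ^ (1 / s)) := by
  refine ⟨fun ε hε => ?_, ?_⟩
  · obtain ⟨g, hg⟩ := exists_schwartzMap_eq_rho φ χ (hω ε hε)
    exact integrable_distribConv v _ g hg
  obtain ⟨C, N, hC, hv⟩ := exists_norm_distribFT_le v
  refine ⟨1, one_pos, C, hC, fun q => ?_⟩
  obtain ⟨A, hA, hρ⟩ := exists_norm_funFT_rho_sub_one_le φ χ q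
  obtain ⟨B, hB, hexp⟩ := exists_pow_le_exp_rpow (zero_lt_one.trans hs) (N + (q + 1))
  refine ⟨A * (2 ^ (N + (q + 1)) * B), by positivity, fun ξ ε hε => ?_⟩
  obtain ⟨g, hg⟩ := exists_schwartzMap_eq_rho φ χ (hω ε hε)
  have hw := hω ε hε
  have hfac : funFT (distribConv v (rho φ χ (ω ε))) ξ - distribFT v ξ =
      distribFT v ξ * (funFT (rho φ χ (ω ε)).fn ξ - 1) := by
    rw [funFT_distribConv v _ g hg]
    ring
  have hgrowth : (1 + ‖ξ‖) ^ (N + (q + 1)) ≤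
      2 ^ (N + (q + 1)) * (B * Real.exp (bracket ξ ^ (1 / s))) := by
    refine (pow_le_pow_left₀ (by positivity) (one_add_norm_le_two_mul_bracket ξ) _).trans ?_
    rw [mul_pow]
    exact mul_le_mul_of_nonneg_left (hexp _ (one_le_bracket ξ)) (by positivity)
  rw [hfac, norm_mul, one_mul]
  calc ‖distribFT v ξ‖ * ‖funFT (rho φ χ (ω ε)).fn ξ - 1‖
      ≤ (C * (1 + ‖ξ‖) ^ N) * (A * ω ε ^ q * (1 + ‖ξ‖) ^ (q + 1)) :=
        mul_le_mul (hv ξ) (hρ _ hw ξ) (norm_nonneg _) (by positivity)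
    _ = (A * C * ω ε ^ q) * (1 + ‖ξ‖) ^ (N + (q + 1)) := by ring
    _ ≤ (A * C * ω ε ^ q) * (2 ^ (N + (q + 1)) * (B * Real.exp (bracket ξ ^ (1 / s)))) := by
        gcongr
    _ = _ := by ring
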